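/- Let $\mathbb D=\{z\in\mathbb C:|z|<1\}$ and let $Bel(\mathbb D)=L^\infty(\mathbb D,\mathbb C)$ be the space of Beltrami differentials on $\mathbb D$. A sequence $\{\varphi_n\}$ of holomorphic functions on $\mathbb D$ with $\iint_{\mathbb D}|\varphi_n|\,dx\,dy=1$ for every $n$ is called degenerating if it converges to $0$ uniformly on compact subsets of $\mathbb D$. For $\mu\in Bel(\mathbb D)$ put $$N(\mu)=\sup_{\{\varphi_n\}}\ \limsup_{n\to\infty}\left|\iint_{\mathbb D}\mu\,\varphi_n\,dx\,dy\right|,$$ where the supremum is taken over all degenerating sequences. Two elements $\mu,\nu\in Bel(\mathbb D)$ are infinitesimally asymptotically equivalent if $N(\mu-\nu)=0$; write $[[\mu]]_{AZ}$ for the equivalence class of $\mu$. The infinitesimal asymptotic space $AZ(\mathbb D)$ (the tangent space at the basepoint of the universal asymptotic Teichmüller space) is the quotient of $Bel(\mathbb D)$ by this equivalence relation, with the norm $\|[[\mu]]_{AZ}\|=N(\mu)$ and the metric $d_{AZ}([[\mu]]_{AZ},[[\nu]]_{AZ})=N(\mu-\nu)$. A straight line in a metric space $Y$ is a subset of $Y$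 that is the image of a distance-preserving map $\mathbb R\to Y$. Theorem. For any two distinct points $x,y\in AZ(\mathbb D)$ there are infinitely many straight lines in $AZ(\mathbb D)$ containing both $x$ and $y$. -/

import Mathlib

open MeasureTheory Filter Topology
open scoped ENNReal

noncomputable section

namespace AsymptoticTangent

/-- The open unit disk of the complex plane. -/
def disk : Set ℂ := Metric.ball (0 : ℂ) 1

/-- The Banach space of Beltrami differentials on the disk: (classes of) measurable functions with
finite `L^∞`-norm. -/
abbrev Bel : Type := Lp ℂ ∞ (volume.restrict disk)

/-- The unit sphere of the space of integrable holomorphic quadratic differentials on the disk. -/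
def IsUnitQuadDiff (φ : ℂ → ℂ) : Prop :=
  DifferentiableOn ℂ φ disk ∧ IntegrableOn φ disk ∧ ∫ z in disk, ‖φ z‖ = 1

/-- Degenerating sequences: sequences in the unit sphere that converge to `0` uniformly on the
compact subsets of the disk. -/
def IsDegenerating (φ : ℕ → ℂ → ℂ) : Prop :=
  (∀ n, IsUnitQuadDiff (φ n)) ∧
    ∀ K : Set ℂ, IsCompact K → K ⊆ disk → TendstoUniformlyOn φ 0 atTop K

/-- The pairing `∬ μ φ dx dy` over the disk. -/
def pairing (μ : Bel) (φ : ℂ → ℂ) : ℂ := ∫ z in disk, μ z * φ z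

/-- `sup limsup |∬ μ φₙ dx dy|`, the supremum being over all degenerating sequences. The value is
taken in `[0, ∞]`; it is finite by `asympSup_le`. -/
def asympSup (μ : Bel) : ℝ≥0∞ :=
  ⨆ (φ : ℕ → ℂ → ℂ) (_ : IsDegenerating φ), limsup (fun n => ‖pairing μ (φ n)‖ₑ) atTop

theorem limsup_le_asympSup (μ : Bel) {φ : ℕ → ℂ → ℂ} (hφ : IsDegenerating φ) :
    limsup (fun n => ‖pairing μ (φ n)‖ₑ) atTop ≤ asympSup μ :=
  le_iSup₂_of_le (f := fun φ (_ : IsDegenerating φ) =>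
    limsup (fun n => ‖pairing μ (φ n)‖ₑ) atTop) φ hφ le_rfl

theorem ae_norm_le (μ : Bel) : ∀ᵐ z ∂(volume.restrict disk), ‖μ z‖ ≤ ‖μ‖ := by
  filter_upwards [enorm_ae_le_eLpNormEssSup μ (volume.restrict disk)] with z hz
  have h := ENNReal.toReal_mono (Lp.eLpNorm_ne_top μ) (by simpa using hz)
  simpa [Lp.norm_def] using h

theorem integrable_mul (μ : Bel) {φ : ℂ → ℂ} (hφ : IsUnitQuadDiff φ) :
    Integrable (fun z => μ z * φ z) (volume.restrict disk) :=
  Integrable.bdd_mul hφ.2.1 (Lp.aestronglyMeasurable μ) (ae_norm_le μ)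

theorem pairing_add (μ ν : Bel) {φ : ℂ → ℂ} (hφ : IsUnitQuadDiff φ) :
    pairing (μ + ν) φ = pairing μ φ + pairing ν φ := by
  unfold pairing
  rw [← integral_add (integrable_mul μ hφ) (integrable_mul ν hφ)]
  refine integral_congr_ae ?_
  filter_upwards [Lp.coeFn_add μ ν] with z hz
  rw [hz, Pi.add_apply, add_mul]

theorem pairing_smul (c : ℂ) (μ : Bel) (φ : ℂ → ℂ) :
    pairing (c • μ) φ = c * pairing μ φ := by
  unfold pairing
  rw [← integral_const_mul]
  refine integral_congr_ae ?_
  filter_upwards [Lp.coeFn_smul c μ] with z hz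
  simp [hz, mul_assoc]

theorem norm_pairing_le (μ : Bel) {φ : ℂ → ℂ} (hφ : IsUnitQuadDiff φ) :
    ‖pairing μ φ‖ ≤ ‖μ‖ := by
  calc ‖pairing μ φ‖ ≤ ∫ z in disk, ‖μ‖ * ‖φ z‖ := by
        refine norm_integral_le_of_norm_le (hφ.2.1.norm.const_mul _) ?_
        filter_upwards [ae_norm_le μ] with z hz
        rw [norm_mul]
        gcongr
    _ = ‖μ‖ := by rw [integral_const_mul, hφ.2.2, mul_one]

theorem asympSup_le (μ : Bel) : asympSup μ ≤ ‖μ‖ₑ := by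
  refine iSup₂_le fun φ hφ => limsup_le_of_le (by isBoundedDefault) (Eventually.of_forall fun n => ?_)
  exact enorm_le_iff_norm_le.2 (norm_pairing_le μ (hφ.1 n))

theorem asympSup_ne_top (μ : Bel) : asympSup μ ≠ ∞ :=
  ((asympSup_le μ).trans_lt enorm_lt_top).ne

theorem limsup_add_le_add (u v : ℕ → ℝ≥0∞) :
    limsup (fun n => u n + v n) atTop ≤ limsup u atTop + limsup v atTop := by
  rw [limsup_eq_iInf_iSup_of_nat (u := u), limsup_eq_iInf_iSup_of_nat (u := v), ENNReal.iInf_add]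
  refine le_iInf fun n => ?_
  rw [ENNReal.add_iInf]
  refine le_iInf fun m => limsup_le_of_le (by isBoundedDefault) ?_
  filter_upwards [eventually_ge_atTop n, eventually_ge_atTop m] with k hn hm
  exact add_le_add (le_iSup₂_of_le (f := fun i (_ : i ≥ n) => u i) k hn le_rfl)
    (le_iSup₂_of_le (f := fun i (_ : i ≥ m) => v i) k hm le_rfl)

theorem asympSup_add_le (μ ν : Bel) : asympSup (μ + ν) ≤ asympSup μ + asympSup ν := by
  refine iSup₂_le fun φ hφ => ?_
  calc limsup (fun n => ‖pairing (μ + ν) (φ n)‖ₑ) atTop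
      ≤ limsup (fun n => ‖pairing μ (φ n)‖ₑ + ‖pairing ν (φ n)‖ₑ) atTop := by
        refine limsup_le_limsup (Eventually.of_forall fun n => ?_)
        simp only [pairing_add μ ν (hφ.1 n)]
        exact enorm_add_le _ _
    _ ≤ limsup (fun n => ‖pairing μ (φ n)‖ₑ) atTop
          + limsup (fun n => ‖pairing ν (φ n)‖ₑ) atTop := limsup_add_le_add _ _
    _ ≤ asympSup μ + asympSup ν := by
        exact add_le_add (limsup_le_asympSup μ hφ) (limsup_le_asympSup ν hφ)

theorem asympSup_smul (c : ℂ) (μ : Bel) : asympSup (c • μ) = ‖c‖ₑ * asympSup μ := by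
  simp only [asympSup, pairing_smul, enorm_mul, ENNReal.mul_iSup,
    ENNReal.limsup_const_mul_of_ne_top enorm_ne_top]

theorem asympSup_neg (μ : Bel) : asympSup (-μ) = asympSup μ := by
  simpa using asympSup_smul (-1) μ

theorem asympSup_zero : asympSup 0 = 0 := by
  simpa using asympSup_smul 0 0

/-- The Beltrami differentials that are infinitesimally asymptotically equivalent to `0`. Two
Beltrami differentials are equivalent when their difference lies in this subspace. -/
def asympTrivial : Submodule ℂ Bel where
  carrier := {μ | asympSup μ = 0}
  add_mem' {μ ν} hμ hν := by
    have h := asympSup_add_le μ ν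
    rw [Set.mem_ofPred_eq] at hμ hν
    rw [hμ, hν, add_zero] at h
    exact le_antisymm h bot_le
  zero_mem' := asympSup_zero
  smul_mem' c μ hμ := by
    rw [Set.mem_ofPred_eq] at hμ ⊢
    rw [asympSup_smul, hμ, mul_zero]

/-- The infinitesimal asymptotic space `AZ` of the disk: the quotient of the Beltrami differentials
by infinitesimal asymptotic equivalence. -/
def AZ : Type := Bel ⧸ asympTrivial

namespace AZ

instance : AddCommGroup AZ := inferInstanceAs (AddCommGroup (Bel ⧸ asympTrivial))

instance : Module ℂ AZ := inferInstanceAs (Module ℂ (Bel ⧸ asympTrivial))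

/-- The class of a Beltrami differential. -/
def mk : Bel →ₗ[ℂ] AZ := asympTrivial.mkQ

theorem mk_surjective : Function.Surjective mk := asympTrivial.mkQ_surjective

theorem mk_eq_mk_iff (μ ν : Bel) : mk μ = mk ν ↔ asympSup (μ - ν) = 0 :=
  Submodule.Quotient.eq asympTrivial

theorem asympSup_le_of_mk_eq {μ ν : Bel} (h : mk μ = mk ν) : asympSup μ ≤ asympSup ν := by
  have h1 := asympSup_add_le (μ - ν) ν
  rwa [sub_add_cancel, (mk_eq_mk_iff μ ν).1 h, zero_add] at h1

/-- The standard infinitesimal asymptotic norm of a class: `sup limsup |∬ μ φₙ dx dy|` for a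
representative `μ`. It does not depend on the representative, see `asympNorm_mk`. -/
def asympNorm (x : AZ) : ℝ := (asympSup (Function.surjInv mk_surjective x)).toReal

theorem asympNorm_mk (μ : Bel) : asympNorm (mk μ) = (asympSup μ).toReal := by
  have h : mk (Function.surjInv mk_surjective (mk μ)) = mk μ :=
    Function.surjInv_eq mk_surjective _
  exact congrArg ENNReal.toReal
    (le_antisymm (asympSup_le_of_mk_eq h) (asympSup_le_of_mk_eq h.symm))

/-- `AZ` carries the infinitesimal asymptotic norm, and the metric `dist x y = ‖x - y‖`. -/
instance : NormedAddCommGroup AZ :=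
  AddGroupNorm.toNormedAddCommGroup
    { toFun := asympNorm
      map_zero' := by
        rw [← map_zero mk, asympNorm_mk, asympSup_zero, ENNReal.toReal_zero]
      add_le' := fun x y => by
        obtain ⟨μ, rfl⟩ := mk_surjective x
        obtain ⟨ν, rfl⟩ := mk_surjective y
        rw [← map_add, asympNorm_mk, asympNorm_mk, asympNorm_mk,
          ← ENNReal.toReal_add (asympSup_ne_top μ) (asympSup_ne_top ν)]
        exact ENNReal.toReal_mono
          (ENNReal.add_ne_top.2 ⟨asympSup_ne_top μ, asympSup_ne_top ν⟩) (asympSup_add_le μ ν)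
      neg' := fun x => by
        obtain ⟨μ, rfl⟩ := mk_surjective x
        rw [← map_neg, asympNorm_mk, asympNorm_mk, asympSup_neg]
      eq_zero_of_map_eq_zero' := fun x hx => by
        obtain ⟨μ, rfl⟩ := mk_surjective x
        rw [asympNorm_mk, ENNReal.toReal_eq_zero_iff] at hx
        rw [← map_zero mk, mk_eq_mk_iff, sub_zero]
        exact hx.resolve_right (asympSup_ne_top μ) }

theorem norm_mk (μ : Bel) : ‖mk μ‖ = (asympSup μ).toReal := asympNorm_mk μ

theorem dist_mk_mk (μ ν : Bel) : dist (mk μ) (mk ν) = (asympSup (μ - ν)).toReal := by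
  rw [dist_eq_norm, ← map_sub, norm_mk]

end AZ

/-- A straight line in a metric space: a subset that is an isometric image of the real line. -/
def IsStraightLine {Y : Type*} [MetricSpace Y] (L : Set Y) : Prop :=
  ∃ γ : ℝ → Y, Isometry γ ∧ Set.range γ = L

end AsymptoticTangent

end

open MeasureTheory Filter Topology
open scoped ENNReal

namespace AsymptoticTangent

/-! Geodesics in `AZ` can be bent. Put `μ = β - α` with `k = N(μ) > 0`. The segment from `[α]` to
`[β]` in the unit direction `μ/k` extends to a line if, from `[β]` on, it continues in any direction
`ω` with `N(a μ/k + b ω) = a + b` for all `a, b ≥ 0`. Such `ω` abound. A single degenerating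
sequence realizes `N(μ)` in the limit (`exists_extremal_degenerating`). Its mass escapes to the
boundary, so a subsequence lives, up to vanishing error, on disjoint annuli
(`IsDegenerating.exists_subseq_concentrated`). Prescribing `ω` on each annulus separately makes its
pairings follow any sequence in the closed unit disk (`IsDegenerating.exists_subseq_interpolating`).
The value `1` at even indices gives the norm identity; a free value `c ∈ [0, 1]` at odd indices
gives infinitely many classes, hence infinitely many lines. -/

/-- The asymptotic norm as a real number. -/
noncomputable def realSup (μ : Bel) : ℝ := (asympSup μ).toReal

theorem realSup_le_norm (μ : Bel) : realSup μ ≤ ‖μ‖ := by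
  simpa [realSup] using ENNReal.toReal_mono enorm_ne_top (asympSup_le μ)

theorem realSup_add_le (μ ν : Bel) : realSup (μ + ν) ≤ realSup μ + realSup ν := by
  rw [realSup, realSup, realSup, ← ENNReal.toReal_add (asympSup_ne_top μ) (asympSup_ne_top ν)]
  exact ENNReal.toReal_mono
    (ENNReal.add_ne_top.2 ⟨asympSup_ne_top μ, asympSup_ne_top ν⟩) (asympSup_add_le μ ν)

theorem realSup_smul (c : ℂ) (μ : Bel) : realSup (c • μ) = ‖c‖ * realSup μ := by
  simp [realSup, asympSup_smul]

theorem dist_mk_mk_eq_realSup (μ ν : Bel) : dist (AZ.mk μ) (AZ.mk ν) = realSup (μ - ν) :=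
  AZ.dist_mk_mk μ ν

/-! ### Extremal degenerating sequences -/

/-- A limit of lower bounds for the pairings along a degenerating sequence bounds the norm. -/
theorem le_realSup_of_tendsto {μ : Bel} {φ : ℕ → ℂ → ℂ} (hφ : IsDegenerating φ) {u : ℕ → ℝ} {a : ℝ}
    (hu : Tendsto u atTop (𝓝 a)) (h : ∀ n, u n ≤ ‖pairing μ (φ n)‖) : a ≤ realSup μ := by
  refine (ENNReal.ofReal_le_iff_le_toReal (asympSup_ne_top μ)).1 ?_
  calc ENNReal.ofReal a = limsup (fun n => ENNReal.ofReal (u n)) atTop :=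
        ((ENNReal.continuous_ofReal.tendsto a).comp hu).limsup_eq.symm
    _ ≤ limsup (fun n => ‖pairing μ (φ n)‖ₑ) atTop := by
        refine limsup_le_limsup (Eventually.of_forall fun n => ?_)
        simpa only [ofReal_norm] using ENNReal.ofReal_le_ofReal (h n)
    _ ≤ asympSup μ := limsup_le_asympSup μ hφ

theorem IsDegenerating.comp {φ : ℕ → ℂ → ℂ} (hφ : IsDegenerating φ) {n : ℕ → ℕ}
    (hn : Tendsto n atTop atTop) : IsDegenerating fun j => φ (n j) :=
  ⟨fun j => hφ.1 (n j), fun K hK hKd => (tendstoUniformlyOn_iff_tendstoUniformlyOnFilter.2 <| by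
    have h := tendstoUniformlyOn_iff_tendstoUniformlyOnFilter.1 (hφ.2 K hK hKd)
    exact fun u hu => (hn.prodMap tendsto_id).eventually (h u hu))⟩

theorem IsUnitQuadDiff.const_mul {φ : ℂ → ℂ} (hφ : IsUnitQuadDiff φ) {c : ℂ} (hc : ‖c‖ = 1) :
    IsUnitQuadDiff fun z => c * φ z :=
  ⟨hφ.1.const_mul c, hφ.2.1.const_mul c, by simpa [hc] using hφ.2.2⟩

theorem pairing_const_mul (μ : Bel) (c : ℂ) (φ : ℂ → ℂ) :
    pairing μ (fun z => c * φ z) = c * pairing μ φ := by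
  unfold pairing
  rw [← integral_const_mul]
  exact integral_congr_ae (Eventually.of_forall fun z => by ring)

theorem exists_norm_eq_one_mul_eq_norm (w : ℂ) : ∃ c : ℂ, ‖c‖ = 1 ∧ c * w = (‖w‖ : ℂ) := by
  rcases eq_or_ne w 0 with rfl | hw
  · exact ⟨1, by simp⟩
  · have h : (‖w‖ : ℂ) ≠ 0 := by simpa using hw
    exact ⟨‖w‖ / w, by simp [hw], by field_simp⟩

theorem closedBall_subset_disk {r : ℝ} (hr : r < 1) : Metric.closedBall (0 : ℂ) r ⊆ disk :=
  Metric.closedBall_subset_ball hr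

/-- Elements of the unit sphere that are small on a given disk and almost norm `μ`. -/
theorem exists_small_almost_extremal (μ : Bel) (hμ : 0 < realSup μ) {r ε : ℝ} (hr : r < 1)
    (hε : 0 < ε) : ∃ φ, IsUnitQuadDiff φ ∧ (∀ z ∈ Metric.closedBall (0 : ℂ) r, ‖φ z‖ < ε) ∧
      realSup μ - ε ≤ (pairing μ φ).re := by
  have hlt : ENNReal.ofReal (realSup μ - ε) < asympSup μ := by
    rw [← ENNReal.ofReal_toReal (asympSup_ne_top μ)]
    exact (ENNReal.ofReal_lt_ofReal_iff hμ).2 (sub_lt_self _ hε)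
  obtain ⟨φ, hφ⟩ := lt_iSup_iff.1 hlt
  obtain ⟨hd, hφ⟩ := lt_iSup_iff.1 hφ
  have h1 := frequently_lt_of_lt_limsup (by isBoundedDefault) hφ
  have h2 := Metric.tendstoUniformlyOn_iff.1
    (hd.2 _ (isCompact_closedBall 0 r) (closedBall_subset_disk hr)) ε hε
  obtain ⟨n, hn1, hn2⟩ := (h1.and_eventually h2).exists
  -- A unimodular factor makes the pairing real and nonnegative, so its modulus becomes its real
  -- part.
  obtain ⟨c, hc, hcw⟩ := exists_norm_eq_one_mul_eq_norm (pairing μ (φ n))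
  refine ⟨fun z => c * φ n z, (hd.1 n).const_mul hc, fun z hz => ?_, ?_⟩
  · simpa [hc] using hn2 z hz
  · rw [pairing_const_mul, hcw, Complex.ofReal_re]
    rw [← ofReal_norm] at hn1
    exact (ENNReal.ofReal_lt_ofReal_iff'.1 hn1).1.le

/-- A diagonal choice: the `n`-th term is below `1/(n+1)` on the disk of radius `1 - 1/(n+1)`, and
these disks eventually contain any given compact set. So one sequence attains the supremum defining
the norm. -/
theorem exists_extremal_degenerating (μ : Bel) (hμ : 0 < realSup μ) :
    ∃ φ, IsDegenerating φ ∧ ∀ n : ℕ, realSup μ - 1 / ((n : ℝ) + 1) ≤ (pairing μ (φ n)).re := by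
  have hpos (n : ℕ) : (0 : ℝ) < 1 / ((n : ℝ) + 1) := by positivity
  choose φ h1 h2 h3 using fun n : ℕ =>
    exists_small_almost_extremal μ hμ (sub_lt_self (1 : ℝ) (hpos n)) (hpos n)
  refine ⟨φ, ⟨h1, fun K hK hKd => Metric.tendstoUniformlyOn_iff.2 fun ε hε => ?_⟩, h3⟩
  obtain ⟨r, hr, hKr⟩ := exists_lt_subset_ball hK.isClosed hKd
  have ht := tendsto_one_div_add_atTop_nhds_zero_nat (𝕜 := ℝ)
  filter_upwards [ht.eventually_lt_const hε, ht.eventually_lt_const (sub_pos.2 hr)] with n hn hn' z hz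
  have hz' := mem_ball_zero_iff.1 (hKr hz)
  have := h2 n z (by rw [mem_closedBall_zero_iff]; linarith)
  simpa using this.trans hn

/-! ### Concentration on disjoint annuli -/

/-- The half-open annulus `r ≤ |z| < s`. -/
def annulus (r s : ℝ) : Set ℂ := {z | ‖z‖ ∈ Set.Ico r s}

theorem measurableSet_annulus (r s : ℝ) : MeasurableSet (annulus r s) :=
  measurable_norm measurableSet_Ico

theorem measurableSet_disk : MeasurableSet disk := measurableSet_ball

theorem IsDegenerating.eventually_integral_le {φ : ℕ → ℂ → ℂ} (hφ : IsDegenerating φ) {r ε : ℝ}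
    (hr : r < 1) (hε : 0 < ε) : ∀ᶠ n in atTop, ∫ z in Metric.closedBall 0 r, ‖φ n z‖ ≤ ε := by
  set V := volume.real (Metric.closedBall (0 : ℂ) r)
  have hV : 0 ≤ V := measureReal_nonneg
  have h := Metric.tendstoUniformlyOn_iff.1
    (hφ.2 _ (isCompact_closedBall 0 r) (closedBall_subset_disk hr)) (ε / (V + 1)) (by positivity)
  filter_upwards [h] with n hn
  have h1 := norm_setIntegral_le_of_norm_le_const (μ := volume) (f := fun z => ‖φ n z‖)
    (s := Metric.closedBall (0 : ℂ) r) (C := ε / (V + 1)) measure_closedBall_lt_top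
    (fun z hz => by simpa using (hn z hz).le)
  calc _ ≤ ε / (V + 1) * V := (le_abs_self _).trans h1
    _ ≤ ε / (V + 1) * (V + 1) := by gcongr; linarith
    _ = ε := by field_simp

theorem IsUnitQuadDiff.exists_integral_ball_gt {φ : ℂ → ℂ} (hφ : IsUnitQuadDiff φ) {r ε : ℝ}
    (hr : r < 1) (hε : 0 < ε) : ∃ s, r < s ∧ s < 1 ∧ 1 - ε < ∫ z in Metric.ball 0 s, ‖φ z‖ := by
  have hU : ⋃ n : ℕ, Metric.ball (0 : ℂ) (1 - 1 / ((n : ℝ) + 1)) = disk := by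
    ext z
    simp only [Set.mem_iUnion, mem_ball_zero_iff, disk]
    refine ⟨fun ⟨n, hn⟩ => hn.trans (sub_lt_self _ (by positivity)), fun hz => ?_⟩
    obtain ⟨n, hn⟩ := exists_nat_one_div_lt (sub_pos.2 hz)
    exact ⟨n, by linarith⟩
  have hm : Monotone fun n : ℕ => Metric.ball (0 : ℂ) (1 - 1 / ((n : ℝ) + 1)) := fun m n hmn =>
    Metric.ball_subset_ball (sub_le_sub_left (Nat.one_div_le_one_div hmn) 1)
  have ht := tendsto_setIntegral_of_monotone (μ := volume) (f := fun z => ‖φ z‖)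
    (fun n => measurableSet_ball) hm (by rw [hU]; exact hφ.2.1.norm)
  rw [hU, hφ.2.2] at ht
  have h0 := tendsto_one_div_add_atTop_nhds_zero_nat (𝕜 := ℝ)
  obtain ⟨n, hn1, hn2⟩ := ((ht.eventually_const_lt (sub_lt_self 1 hε)).and
    (h0.eventually_lt_const (sub_pos.2 hr))).exists
  exact ⟨_, by linarith, sub_lt_self _ (by positivity), hn1⟩

/-- Far members of a degenerating sequence concentrate on annuli near the boundary. -/
theorem IsDegenerating.exists_concentrated {φ : ℕ → ℂ → ℂ} (hφ : IsDegenerating φ) (m : ℕ) {r ε : ℝ}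
    (hr : r < 1) (hε : 0 < ε) : ∃ n s, m < n ∧ r < s ∧ s < 1 ∧
      ∫ z in disk \ annulus r s, ‖φ n z‖ ≤ ε := by
  obtain ⟨n, hn, hmn⟩ :=
    ((hφ.eventually_integral_le hr (half_pos hε)).and (eventually_gt_atTop m)).exists
  obtain ⟨s, hrs, hs, hsi⟩ := (hφ.1 n).exists_integral_ball_gt hr (half_pos hε)
  refine ⟨n, s, hmn, hrs, hs, ?_⟩
  have hint : IntegrableOn (fun z => ‖φ n z‖) disk := (hφ.1 n).2.1.norm
  have hbd : Metric.ball (0 : ℂ) s ⊆ disk := Metric.ball_subset_ball hs.le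
  have hsub : disk \ annulus r s ⊆ Metric.closedBall 0 r ∪ disk \ Metric.ball 0 s := by
    rintro z ⟨hz, hza⟩
    simp only [annulus, Set.mem_ofPred_eq, Set.mem_Ico, not_and, not_lt] at hza
    rcases le_total ‖z‖ r with h | h
    · exact Or.inl (by simpa using h)
    · exact Or.inr ⟨hz, by simpa using hza h⟩
  have hd : ∫ z in disk \ Metric.ball 0 s, ‖φ n z‖ = 1 - ∫ z in Metric.ball 0 s, ‖φ n z‖ := by
    rw [setIntegral_sdiff measurableSet_ball hint hbd, (hφ.1 n).2.2]
  have hic := hint.mono_set (closedBall_subset_disk hr)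
  have hid := hint.mono_set (Set.sdiff_subset (s := disk) (t := Metric.ball 0 s))
  have h1 : ∫ z in disk \ annulus r s, ‖φ n z‖ ≤
      ∫ z in Metric.closedBall 0 r ∪ disk \ Metric.ball 0 s, ‖φ n z‖ :=
    setIntegral_mono_set (hic.union hid) (Eventually.of_forall fun z => norm_nonneg _)
      hsub.eventuallyLE
  rw [setIntegral_union (Set.disjoint_sdiff_right.mono_left (Metric.closedBall_subset_ball hrs))
    (measurableSet_disk.diff measurableSet_ball) hic hid] at h1
  linarith

/-- Every degenerating sequence has a subsequence concentrated on disjoint annuli. -/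
theorem IsDegenerating.exists_subseq_concentrated {φ : ℕ → ℂ → ℂ} (hφ : IsDegenerating φ) :
    ∃ (n : ℕ → ℕ) (r : ℕ → ℝ), StrictMono n ∧ Monotone r ∧
      ∀ j : ℕ, ∫ z in disk \ annulus (r j) (r (j + 1)), ‖φ (n j) z‖ ≤ 1 / ((j : ℝ) + 1) := by
  choose N S hN hS hS1 hI using fun (j : ℕ) (p : ℕ × Set.Iio (1 : ℝ)) =>
    hφ.exists_concentrated p.1 p.2.2 (show (0 : ℝ) < 1 / ((j : ℝ) + 1) by positivity)
  -- The state is the last index used and the current inner radius. Step `j` chooses a later index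
  -- together with an outer radius, which is the next inner radius; hence the index belonging to
  -- annulus `j` is read off from state `j + 1`.
  let s : ℕ → ℕ × Set.Iio (1 : ℝ) := fun j =>
    Nat.rec (0, ⟨0, by simp⟩) (fun j p => (N j p, ⟨S j p, hS1 j p⟩)) j
  exact ⟨fun j => (s (j + 1)).1, fun j => (s j).2, strictMono_nat_of_lt_succ fun j => hN _ _,
    monotone_nat_of_le_succ fun j => (hS j (s j)).le, fun j => hI j (s j)⟩

/-! ### Interpolation of pairings -/

/-- Bounded sequences are interpolated by pairings along a sequence concentrated on disjoint
annuli. -/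
theorem exists_interpolating {φ : ℕ → ℂ → ℂ} (hφ : ∀ j, IsUnitQuadDiff (φ j)) {r : ℕ → ℝ}
    (hr : Monotone r) {c : ℕ → ℂ} (hc : ∀ j, ‖c j‖ ≤ 1) :
    ∃ ω : Bel, ‖ω‖ ≤ 1 ∧ ∀ j, ‖pairing ω (φ j) - c j‖ ≤
      2 * ∫ z in disk \ annulus (r j) (r (j + 1)), ‖φ j z‖ := by
  have hdisj : Pairwise (Function.onFun Disjoint fun j => annulus (r j) (r (j + 1))) :=
    fun i j hij => (hr.pairwise_disjoint_on_Ico_succ hij).preimage _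
  -- On the disk `g j * φ j = c j * |φ j|`, whose integral is `c j`. The indicator gives
  -- measurability on all of `ℂ`, and division by zero yields `0` at zeros of `φ j`, so `|g j| ≤ 1`
  -- everywhere.
  let g : ℕ → ℂ → ℂ := fun j z =>
    c j * (starRingEnd ℂ (disk.indicator (φ j) z) / ‖disk.indicator (φ j) z‖)
  have hφm (j : ℕ) : Measurable (disk.indicator (φ j)) := by
    classical
    rw [← Set.piecewise_eq_indicator]
    exact (hφ j).1.continuousOn.measurable_piecewise continuousOn_const measurableSet_disk
  have hgm (j : ℕ) : Measurable (g j) :=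
    ((Complex.continuous_conj.measurable.comp (hφm j)).div
      (Complex.measurable_ofReal.comp (hφm j).norm)).const_mul _
  have hg1 (j : ℕ) (z : ℂ) : ‖g j z‖ ≤ 1 := by
    simp only [g, norm_mul, norm_div, RCLike.norm_conj, Complex.norm_real, norm_norm]
    exact mul_le_one₀ (hc j) (by positivity) (div_self_le_one _)
  obtain ⟨f, hfm, hfg⟩ := exists_measurable_piecewise _
    (fun j => measurableSet_annulus (r j) (r (j + 1))) g hgm
    (fun i j hij z hz => (Set.disjoint_left.1 (hdisj hij) hz.1 hz.2).elim)
  -- Nothing is known about `f` off the annuli; truncating to `T` bounds it there and changes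
  -- nothing on them.
  let T : Set ℂ := {z | ‖f z‖ ≤ 1}
  have hT : MeasurableSet T := measurableSet_le hfm.norm measurable_const
  have hb (z : ℂ) : ‖T.indicator f z‖ ≤ 1 := by
    by_cases hz : z ∈ T
    · rw [Set.indicator_of_mem hz]
      exact hz
    · simp [hz]
  have hmem : MemLp (T.indicator f) ∞ (volume.restrict disk) :=
    memLp_top_of_bound (hfm.indicator hT).aestronglyMeasurable 1 (Eventually.of_forall hb)
  refine ⟨hmem.toLp _, ?_, fun j => ?_⟩
  · rw [Lp.norm_toLp]
    refine ENNReal.toReal_le_of_le_ofReal zero_le_one ?_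
    rw [eLpNorm_exponent_top]
    exact eLpNormEssSup_le_of_ae_bound (Eventually.of_forall hb)
  set A := annulus (r j) (r (j + 1))
  have hA : MeasurableSet A := measurableSet_annulus _ _
  have hint : IntegrableOn (fun z => ‖φ j z‖) disk := (hφ j).2.1.norm
  have hc' : c j = ∫ z in disk, c j * (‖φ j z‖ : ℂ) := by
    rw [integral_const_mul, integral_complex_ofReal, (hφ j).2.2, Complex.ofReal_one, mul_one]
  unfold pairing
  conv_lhs => rw [hc']
  have hint' : IntegrableOn (fun z => c j * (‖φ j z‖ : ℂ)) disk :=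
    (hint.ofReal (𝕜 := ℂ)).const_mul (c j)
  rw [← integral_sub (integrable_mul (hmem.toLp _) (hφ j)) hint']
  -- The two integrands agree on the annulus; off it each is at most `|φ j|` in modulus, whence the
  -- factor `2`.
  calc _ ≤ ∫ z in disk, Aᶜ.indicator (fun z => 2 * ‖φ j z‖) z := by
        refine norm_integral_le_of_norm_le ((hint.const_mul 2).indicator hA.compl) ?_
        filter_upwards [hmem.coeFn_toLp, ae_restrict_mem measurableSet_disk] with z hz hzd
        rw [hz]
        by_cases hzA : z ∈ A
        · have hzT : z ∈ T := by
            simp only [T, Set.mem_ofPred_eq, hfg j hzA, hg1]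
          have : g j z * φ j z = c j * ‖φ j z‖ := by
            simp only [g, Set.indicator_of_mem hzd]
            rcases eq_or_ne (φ j z) 0 with h0 | h0
            · simp [h0]
            · have h0' : (‖φ j z‖ : ℂ) ≠ 0 := by simpa using h0
              have := Complex.conj_mul' (φ j z)
              field_simp
              rw [mul_assoc, this]
          simp [hzT, hfg j hzA, this, hzA]
        · rw [Set.indicator_of_mem (show z ∈ Aᶜ from hzA)]
          calc _ ≤ ‖T.indicator f z * φ j z‖ + ‖c j * (‖φ j z‖ : ℂ)‖ := norm_sub_le _ _
            _ ≤ 1 * ‖φ j z‖ + 1 * ‖φ j z‖ := by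
              rw [norm_mul, norm_mul, Complex.norm_real, norm_norm]
              gcongr
              exacts [hb z, hc j]
            _ = _ := by ring
    _ = _ := by
        rw [setIntegral_indicator hA.compl, integral_const_mul]
        rfl

/-- The annuli depend only on the sequence, so one subsequence serves every `c`. -/
theorem IsDegenerating.exists_subseq_interpolating {φ : ℕ → ℂ → ℂ} (hφ : IsDegenerating φ) :
    ∃ n : ℕ → ℕ, StrictMono n ∧ ∀ c : ℕ → ℂ, (∀ j, ‖c j‖ ≤ 1) → ∃ ω : Bel, ‖ω‖ ≤ 1 ∧
      Tendsto (fun j => pairing ω (φ (n j)) - c j) atTop (𝓝 0) := by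
  obtain ⟨n, r, hn, hr, hI⟩ := hφ.exists_subseq_concentrated
  refine ⟨n, hn, fun c hc => ?_⟩
  obtain ⟨ω, hω, h⟩ := exists_interpolating (fun j => hφ.1 (n j)) hr hc
  refine ⟨ω, hω, squeeze_zero_norm (fun j => (h j).trans
    (mul_le_mul_of_nonneg_left (hI j) zero_le_two)) ?_⟩
  simpa using (tendsto_one_div_add_atTop_nhds_zero_nat (𝕜 := ℝ)).const_mul 2

/-! ### Bent lines -/

/-- The path that runs through `x` in the direction `u` up to time `k` and then in the direction
`v`. -/
noncomputable def bentLine (α u v : Bel) (k t : ℝ) : Bel :=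
  α + ((min t k : ℝ) : ℂ) • u + ((max (t - k) 0 : ℝ) : ℂ) • v

/-- Both `min t k` and `max (t - k) 0` are nondecreasing and they sum to `t`. A forward increment is
therefore `a u + b v` with `a, b ≥ 0` and `a + b` the elapsed time. -/
theorem isometry_bentLine (α u v : Bel) (k : ℝ)
    (h : ∀ a b : ℝ, 0 ≤ a → 0 ≤ b → realSup ((a : ℂ) • u + (b : ℂ) • v) = a + b) :
    Isometry fun t => AZ.mk (bentLine α u v k t) := by
  have key {s t : ℝ} (hst : s ≤ t) :
      dist (AZ.mk (bentLine α u v k t)) (AZ.mk (bentLine α u v k s)) = t - s := by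
    have h1 : bentLine α u v k t - bentLine α u v k s =
        ((min t k - min s k : ℝ) : ℂ) • u + ((max (t - k) 0 - max (s - k) 0 : ℝ) : ℂ) • v := by
      simp only [bentLine, Complex.ofReal_sub]
      module
    rw [dist_mk_mk_eq_realSup, h1, h _ _ (sub_nonneg.2 (min_le_min_right _ hst))
      (sub_nonneg.2 (max_le_max_right _ (by linarith)))]
    grind
  refine Isometry.of_dist_eq fun s t => ?_
  rcases le_total s t with hst | hst
  · rw [dist_comm, key hst, dist_comm, Real.dist_eq, abs_of_nonneg (sub_nonneg.2 hst)]
  · rw [key hst, Real.dist_eq, abs_of_nonneg (sub_nonneg.2 hst)]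

theorem bentLine_zero (α u v : Bel) {k : ℝ} (hk : 0 ≤ k) : bentLine α u v k 0 = α := by
  simp [bentLine, hk]

theorem bentLine_self (α u v : Bel) (k : ℝ) : bentLine α u v k k = α + (k : ℂ) • u := by
  simp [bentLine]

/-- Lines with the same range that agree at `0` and `k ≠ 0` agree everywhere. -/
theorem eq_of_isometry_of_range_eq {Y : Type*} [MetricSpace Y] {γ δ : ℝ → Y} (hγ : Isometry γ)
    (hδ : Isometry δ) (hr : Set.range γ = Set.range δ) {k : ℝ} (hk : k ≠ 0) (h0 : γ 0 = δ 0)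
    (h1 : γ k = δ k) : γ = δ := by
  funext t
  obtain ⟨s, hs⟩ : γ t ∈ Set.range δ := hr ▸ Set.mem_range_self t
  have e0 : |s| = |t| := by
    have := hδ.dist_eq s 0
    rw [hs, ← h0, hγ.dist_eq] at this
    simpa [Real.dist_eq] using this.symm
  have e1 : |s - k| = |t - k| := by
    have := hδ.dist_eq s k
    rw [hs, ← h1, hγ.dist_eq] at this
    simpa [Real.dist_eq] using this.symm
  rw [← hs]
  congr 1
  -- A real number is determined by its distances to `0` and `k`: the reflections about these two
  -- points agree nowhere.
  rcases abs_eq_abs.1 e0 with h | h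
  · exact h
  · rcases abs_eq_abs.1 e1 with h' | h'
    · linarith
    · exact absurd (by linarith : k = 0) hk

/-- Infinitely many directions of unit speed in which the ray from `0` through `μ` can be bent. -/
theorem exists_bending_directions (μ : Bel) (hμ : 0 < realSup μ) :
    ∃ ω : Set.Icc (0 : ℝ) 1 → Bel, (Function.Injective fun c => AZ.mk (ω c)) ∧
      ∀ c, ∀ a b : ℝ, 0 ≤ a → 0 ≤ b →
        realSup ((a : ℂ) • ((realSup μ : ℂ)⁻¹ • μ) + (b : ℂ) • ω c) = a + b := by
  set k := realSup μ
  obtain ⟨φ, hφ, hext⟩ := exists_extremal_degenerating μ hμ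
  obtain ⟨n, hn, hω⟩ := hφ.exists_subseq_interpolating
  -- Even indices align `ω c` with `μ`; odd indices record the parameter `c`.
  let C : Set.Icc (0 : ℝ) 1 → ℕ → ℂ := fun c j => if Even j then 1 else ((c : ℝ) : ℂ)
  have hC (c) (j : ℕ) : ‖C c j‖ ≤ 1 := by
    simp only [C]
    split_ifs
    · simp
    · rw [Complex.norm_real, Real.norm_of_nonneg c.2.1]
      exact c.2.2
  choose ω hω1 hωt using fun c => hω (C c) (hC c)
  have heven : Tendsto (fun i : ℕ => 2 * i) atTop atTop :=
    tendsto_atTop_mono (fun i => show i ≤ _ by lia) tendsto_id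
  have hodd : Tendsto (fun i : ℕ => 2 * i + 1) atTop atTop :=
    tendsto_atTop_mono (fun i => show i ≤ _ by lia) tendsto_id
  refine ⟨ω, fun c d hcd => ?_, fun c a b ha hb => le_antisymm ?_ ?_⟩
  -- Along the odd subsequence the pairings of `ω c - ω d` tend to `c - d`, so equal classes force
  -- `c = d`.
  · have hdeg : IsDegenerating fun i => φ (n (2 * i + 1)) := hφ.comp (hn.tendsto_atTop.comp hodd)
    have hp (i : ℕ) : pairing (ω c - ω d) (φ (n (2 * i + 1))) =
        pairing (ω c) (φ (n (2 * i + 1))) - pairing (ω d) (φ (n (2 * i + 1))) := by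
      rw [sub_eq_add_neg, pairing_add _ _ (hdeg.1 i), ← neg_one_smul ℂ (ω d), pairing_smul]
      ring
    have ht : Tendsto (fun i => ‖pairing (ω c - ω d) (φ (n (2 * i + 1)))‖) atTop
        (𝓝 ‖((c : ℝ) : ℂ) - ((d : ℝ) : ℂ)‖) := by
      have h := (((hωt c).comp hodd).sub ((hωt d).comp hodd)).add_const
        (((c : ℝ) : ℂ) - ((d : ℝ) : ℂ))
      rw [sub_zero, zero_add] at h
      refine (h.congr fun i => ?_).norm
      simp only [hp, Function.comp, C, if_neg (Nat.not_even_two_mul_add_one i)]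
      ring
    have hle := le_realSup_of_tendsto hdeg ht fun _ => le_rfl
    rw [realSup, (AZ.mk_eq_mk_iff _ _).1 hcd, ENNReal.toReal_zero] at hle
    have := norm_le_zero_iff.1 hle
    exact Subtype.ext (by exact_mod_cast sub_eq_zero.1 this)
  · refine (realSup_add_le _ _).trans ?_
    rw [realSup_smul, realSup_smul, realSup_smul, norm_inv, Complex.norm_real, Complex.norm_real,
      Complex.norm_real, Real.norm_of_nonneg ha, Real.norm_of_nonneg hb, Real.norm_of_nonneg hμ.le,
      inv_mul_cancel₀ hμ.ne', mul_one]
    have := (realSup_le_norm (ω c)).trans (hω1 c)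
    nlinarith
  -- Along the even subsequence the real parts of the pairings of `μ/k` and `ω c` are asymptotically
  -- at least `1`, so no cancellation occurs and the triangle inequality is sharp.
  · have hdeg : IsDegenerating fun i => φ (n (2 * i)) := hφ.comp (hn.tendsto_atTop.comp heven)
    let p : ℕ → ℝ := fun i => (pairing (ω c) (φ (n (2 * i)))).re
    have hp : Tendsto p atTop (𝓝 1) := by
      have h := ((Complex.continuous_re.tendsto _).comp ((hωt c).comp heven)).add_const 1
      rw [Complex.zero_re, zero_add] at h
      refine h.congr fun i => ?_
      simp [p, C]
    have hq : Tendsto (fun i => k - 1 / ((n (2 * i) : ℝ) + 1)) atTop (𝓝 k) := by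
      simpa using ((tendsto_one_div_add_atTop_nhds_zero_nat (𝕜 := ℝ)).comp
        (hn.tendsto_atTop.comp heven)).const_sub k
    have hlim : Tendsto (fun i => a * (k⁻¹ * (k - 1 / ((n (2 * i) : ℝ) + 1))) + b * p i) atTop
        (𝓝 (a + b)) := by
      have := ((hq.const_mul k⁻¹).const_mul a).add (hp.const_mul b)
      rwa [inv_mul_cancel₀ hμ.ne', mul_one, mul_one] at this
    refine le_realSup_of_tendsto hdeg hlim fun i => le_trans ?_ (Complex.re_le_norm _)
    rw [pairing_add _ _ (hdeg.1 i), pairing_smul, pairing_smul, pairing_smul, Complex.add_re,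
      Complex.re_ofReal_mul, Complex.re_ofReal_mul, ← Complex.ofReal_inv, Complex.re_ofReal_mul]
    gcongr
    exact hext _

end AsymptoticTangent

open AsymptoticTangent in
theorem theorem8p2 (x y : AsymptoticTangent.AZ) (hxy : x ≠ y) :
    {L : Set AsymptoticTangent.AZ |
      AsymptoticTangent.IsStraightLine L ∧ x ∈ L ∧ y ∈ L}.Infinite := by
  obtain ⟨α, rfl⟩ := AZ.mk_surjective x
  obtain ⟨β, rfl⟩ := AZ.mk_surjective y
  have hk : 0 < realSup (β - α) := by
    rw [← dist_mk_mk_eq_realSup]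
    exact dist_pos.2 hxy.symm
  set k := realSup (β - α) with hkdef
  obtain ⟨ω, hinj, hω⟩ := exists_bending_directions (β - α) hk
  let γ (c : Set.Icc (0 : ℝ) 1) (t : ℝ) : AZ := AZ.mk (bentLine α ((k : ℂ)⁻¹ • (β - α)) (ω c) k t)
  have hγ (c) : Isometry (γ c) := isometry_bentLine _ _ _ _ (hω c)
  have h0 (c) : γ c 0 = AZ.mk α := by simp only [γ, bentLine_zero _ _ _ hk.le]
  have h1 (c) : γ c k = AZ.mk β := by
    have : (k : ℂ) ≠ 0 := by exact_mod_cast hk.ne'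
    simp only [γ, bentLine_self, smul_inv_smul₀ this, add_sub_cancel]
  have : Infinite (Set.Icc (0 : ℝ) 1) := (Set.Icc_infinite zero_lt_one).to_subtype
  refine Set.infinite_of_injective_forall_mem (f := fun c => Set.range (γ c)) (fun c d hcd => ?_)
    fun c => ⟨⟨γ c, hγ c, rfl⟩, ⟨0, h0 c⟩, ⟨k, h1 c⟩⟩
  -- All the curves agree at times `0` and `k`, so equal ranges force equal parametrizations. At
  -- time `k + 1`, one unit past the bend, they then give equal classes of `ω c` and `ω d`.
  have h := congrFun (eq_of_isometry_of_range_eq (hγ c) (hγ d) hcd hk.ne' ((h0 c).trans (h0 d).symm)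
    ((h1 c).trans (h1 d).symm)) (k + 1)
  simp only [γ, bentLine, map_add, add_sub_cancel_left, max_eq_left zero_le_one, Complex.ofReal_one,
    one_smul] at h
  exact hinj (add_left_cancel h)
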